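/- **Conventions.** Let $B$ be a separable $\mathbb Z/2$-graded $C^*$-algebra with grading automorphism $\gamma$, and let $(B,H,D_B)$ be a spectral triple: $B$ is represented by a graded $*$-homomorphism $\rho$ on a graded Hilbert space $H$, $D_B$ is odd and selfadjoint, $\rho(b)(1+D_B^2)^{-1}$ is compact for all $b\in B$, and $\mathcal B_1$ (below) is dense in $B$. Put $\mathcal B_0=B$, $\theta_0=\pi_0=\rho$. For $b\in\mathcal B_n$, $\theta_n(b)$ is a bounded operator on $H^{\oplus 2^n}$. Let $D_B$ act diagonally on $H^{\oplus 2^n}$, let $[\cdot,\cdot]$ be the graded commutator, and define recursively $\mathcal B_{n+1}$ as the graded subalgebra of those $b\in\mathcal B_n$ for which $[D_B,\theta_n(b)]$ is bounded (for $b$ and for $\gamma(b)$), and $$\pi_{n+1}(b)=\begin{pmatrix}\theta_n(b)&0\\ [D_B,\theta_n(b)]&\theta_n(\gamma(b))\end{pmatrix},\qquad \theta_{n+1}(b)=q_{n+1}\pi_{n+1}(b)q_{n+1}+q_{n+1}'\pi_{n+1}(b)q_{n+1}',$$ where $q_{n}=p_{n}\cdots p_1$, $q_n'=(1-p_n)\cdots(1-p_1)$,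 and $p_{n}$ is the diagonal amplification of the projection $\begin{pmatrix}(1+D_B^2)^{-1}&D_B(1+D_B^2)^{-1}\\D_B(1+D_B^2)^{-1}&D_B^2(1+D_B^2)^{-1}\end{pmatrix}$ of the diagonal operator $D_B$ on $H^{\oplus 2^{n-1}}$. The $k$-norm $\|\cdot\|_k$ of a matrix over $\mathcal B_k$ is its operator norm in the representation $\bigoplus_{j=0}^k\pi_j$ (together with its $C^*$-norm over $B$, in case $\rho$ is not faithful). $B$ is a *$C^k$-algebra* if $\mathcal B_k$ is dense in $B$. A right $C^*$-module $\mathcal E$ over a $C^k$-algebra $B$ is a *$C^k$-module* if there are $x_i\in\mathcal E$ ($i\in\mathbb Z\setminus\{0\}$) such that $u_n=\sum_{1\le|i|\le n}x_i\otimes x_i$ is an approximate unit of $\mathbb K_B(\mathcal E)$, all $\langle x_i,x_j\rangle$ lie in $\mathcal B_k$, and the infinite matrix $(\langle x_i,x_j\rangle)_{i,j}$ has finite $k$-norm. Then $$E^k=\Big\{e\in\mathcal E:\ \langle x_i,e\rangle\in\mathcal B_k,\ \|e\|_{E^k}:=\sup_n\Big\|\sum_{1\le |i|\le n}e_i\langle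 x_i,e\rangle\Big\|_k<\infty\Big\},$$ where the $e_i$ are the standard basis columns; $E^k$ has the topology of this norm and the inner product of $\mathcal E$. $\mathrm{End}^*_{\mathcal B_k}(E^k\oplus E^k)$ is the set of maps on $E^k\oplus E^k$ that have an adjoint for the inner product $\langle(e_1,e_2),(f_1,f_2)\rangle=\langle e_1,f_1\rangle+\langle e_2,f_2\rangle$. An operator $D:\mathrm{Dom}\,D\to E^k$ is *selfadjoint and regular* in $E^k$ if it is closed, $\mathrm{Dom}\,D\subset E^k$ is dense, $D$ is symmetric, $\mathrm{Dom}\,D=\mathrm{Dom}\,D^*$, and $D+i$ and $D-i$ map $\mathrm{Dom}\,D$ onto $E^k$. Its graph is $\mathfrak G(D)=\{(e,De):e\in\mathrm{Dom}\,D\}$. **Theorem.** Let $k\ge0$, let $\mathcal E$ be a $C^k$-module over a $C^k$-algebra $B$, and let $D$ be a selfadjoint regular operator in $E^k$. Then $1+D^2:\mathrm{Dom}\,D^2\to E^k$ is bijective, and $$p_D=\begin{pmatrix}(1+D^2)^{-1}&D(1+D^2)^{-1}\\D(1+D^2)^{-1}&D^2(1+D^2)^{-1}\end{pmatrix}$$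 is everywhere defined and is a projection in $\mathrm{End}^*_{\mathcal B_k}(E^k\oplus E^k)$, that is, $p_D=p_D^*=p_D^2$. Its range is $\mathfrak G(D)$. Moreover, $v:(x,y)\mapsto(-y,x)$ is a unitary in $\mathrm{End}^*_{\mathcal B_k}(E^k\oplus E^k)$, and $E^k\oplus E^k=\mathfrak G(D)\oplus v\,\mathfrak G(D)$ is an orthogonal direct sum. -/

import Mathlib

open scoped InnerProductSpace

namespace NCG

noncomputable section

/-! ### Partially defined operators -/

section PartialOperators

variable {X : Type*} [AddCommGroup X] [Module ℂ X]

/-- `R = (1 + D²)⁻¹`, everywhere defined: `R x = e` if and only if `e ∈ Dom D²` and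
`e + D² e = x`. -/
def IsInvOneAddSq (D : X →ₗ.[ℂ] X) (R : X → X) : Prop :=
  ∀ x e, R x = e ↔ ∃ f g, (e, f) ∈ D.graph ∧ (f, g) ∈ D.graph ∧ e + g = x

/-- `Q = D ∘ R`, everywhere defined: `R x ∈ Dom D` and `D (R x) = Q x` for all `x`. -/
def IsCompOf (D : X →ₗ.[ℂ] X) (R Q : X → X) : Prop := ∀ x, (R x, Q x) ∈ D.graph

/-- `p` is the operator matrix
`[(1 + D²)⁻¹, D (1 + D²)⁻¹; D (1 + D²)⁻¹, D² (1 + D²)⁻¹]` on `X ⊕ X`. -/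
def IsWoronowiczMatrix (D : X →ₗ.[ℂ] X) (p : (X × X) →ₗ[ℂ] (X × X)) : Prop :=
  ∃ R Q T : X →ₗ[ℂ] X, IsInvOneAddSq D R ∧ IsCompOf D R Q ∧ IsCompOf D Q T ∧
    ∀ x y, p (x, y) = (R x + Q y, Q x + T y)

/-- The map `v : (x, y) ↦ (-y, x)`. -/
def vMap (X : Type*) [AddCommGroup X] [Module ℂ X] : (X × X) →ₗ[ℂ] (X × X) :=
  (-LinearMap.snd ℂ X X).prod (LinearMap.fst ℂ X X)

end PartialOperators

/-! ### Selfadjoint operators in a Hilbert space -/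

section Hilbert

variable {H : Type*} [NormedAddCommGroup H] [InnerProductSpace ℂ H]

open Classical in
/-- The bounded operator `(1 + D²)⁻¹` on a Hilbert space. -/
def invOneAddSq (D : H →ₗ.[ℂ] H) : H →L[ℂ] H :=
  if h : ∃ R : H →L[ℂ] H, IsInvOneAddSq D R then h.choose else 0

open Classical in
/-- The composition `D ∘ R` of `D` and a bounded operator `R`, as a bounded operator. -/
def bddComp (D : H →ₗ.[ℂ] H) (R : H →L[ℂ] H) : H →L[ℂ] H :=
  if h : ∃ Q : H →L[ℂ] H, IsCompOf D R Q then h.choose else 0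

/-- For a selfadjoint `D` the operators `(1 + D²)⁻¹`, `D (1 + D²)⁻¹`, `D² (1 + D²)⁻¹` exist as
bounded operators. -/
lemma exists_invOneAddSq [CompleteSpace H] {D : H →ₗ.[ℂ] H} (hD : IsSelfAdjoint D) :
    ∃ R Q T : H →L[ℂ] H, IsInvOneAddSq D R ∧ IsCompOf D R Q ∧ IsCompOf D Q T := by
  have hadj : D.graph = D.graph.adjoint := by
    have h := LinearPMap.adjoint_graph_eq_graph_adjoint hD.dense_domain
    rwa [LinearPMap.isSelfAdjoint_def.mp hD] at h
  let L := WithLp.prodContinuousLinearEquiv 2 ℂ H H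
  let G : Submodule ℂ (WithLp 2 (H × H)) := D.graph.comap (L : WithLp 2 (H × H) →ₗ[ℂ] H × H)
  have hG : IsClosed (G : Set (WithLp 2 (H × H))) :=
    (show IsClosed (D.graph : Set (H × H)) from hD.isClosed).preimage L.continuous
  have : CompleteSpace G := hG.completeSpace_coe
  let P : H →L[ℂ] H × H :=
    (L : WithLp 2 (H × H) →L[ℂ] H × H) ∘L G.starProjection ∘L
      (L.symm : H × H →L[ℂ] WithLp 2 (H × H)) ∘L ContinuousLinearMap.inl ℂ H H
  have hP : ∀ x, P x ∈ D.graph := fun x => G.starProjection_apply_mem _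
  have hP' : ∀ x, ((P x).2, x - (P x).1) ∈ D.graph := by
    intro x
    rw [hadj, Submodule.mem_adjoint_iff]
    intro a b hab
    have hmem : L.symm (a, b) ∈ G := by simpa [G] using hab
    have h := Submodule.inner_right_of_mem_orthogonal hmem
      (G.sub_starProjection_mem_orthogonal (L.symm (x, 0)))
    rw [WithLp.prod_inner_apply] at h
    have h' : inner ℂ a (x - (P x).1) + inner ℂ b (0 - (P x).2) = 0 := h
    rw [zero_sub, inner_neg_right] at h'
    linear_combination -h'
  refine ⟨ContinuousLinearMap.fst ℂ H H ∘L P, ContinuousLinearMap.snd ℂ H H ∘L P,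
    ContinuousLinearMap.id ℂ H - ContinuousLinearMap.fst ℂ H H ∘L P, ?_, hP, hP'⟩
  intro x e
  constructor
  · rintro rfl
    exact ⟨_, _, hP x, hP' x, by simp⟩
  · rintro ⟨f, g, hef, hfg, hx⟩
    have h1 := D.graph.sub_mem (hP x) hef
    have h2 := D.graph.sub_mem (hP' x) hfg
    have h3 : ((P x).2 - f, x - (P x).1 - g) ∈ D.graph.adjoint := hadj ▸ h2
    have h4 := (Submodule.mem_adjoint_iff _ _).1 h3 _ _ h1
    have h5 : x - (P x).1 - g = -((P x).1 - e) := by rw [← hx]; abel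
    dsimp only at h4
    rw [h5, inner_neg_right, sub_neg_eq_add] at h4
    have h6 := congrArg Complex.re h4
    have h7 : 0 ≤ (inner ℂ ((P x).2 - f) ((P x).2 - f)).re := inner_self_nonneg (𝕜 := ℂ)
    have h8 : 0 ≤ (inner ℂ ((P x).1 - e) ((P x).1 - e)).re := inner_self_nonneg (𝕜 := ℂ)
    have h9 : (inner ℂ ((P x).1 - e) ((P x).1 - e)).re = 0 := by
      simp only [Complex.add_re, Complex.zero_re] at h6
      change _ + (inner ℂ ((P x).1 - e) ((P x).1 - e)).re = 0 at h6
      linarith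
    have h10 : ‖(P x).1 - e‖ ^ 2 = 0 := by
      rw [← inner_self_eq_norm_sq (𝕜 := ℂ)]
      exact h9
    exact sub_eq_zero.1 (norm_eq_zero.1 (pow_eq_zero_iff two_ne_zero |>.1 h10))

/-- `c` is the (bounded extension of the) graded commutator `[D, x] = D x - x' D`, where `x'` is
the image of `x` under the grading automorphism: `x` preserves `Dom D`, and
`D x e - x' D e = c e` for `e ∈ Dom D`. -/
def IsGradedComm (D : H →ₗ.[ℂ] H) (x x' c : H →L[ℂ] H) : Prop :=
  ∀ e f, (e, f) ∈ D.graph → (x e, x' f + c e) ∈ D.graph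

open Classical in
/-- The bounded operator `[D, x] = D x - x' D`. -/
def gradedComm (D : H →ₗ.[ℂ] H) (x x' : H →L[ℂ] H) : H →L[ℂ] H :=
  if h : ∃ c, IsGradedComm D x x' c then h.choose else 0

lemma IsGradedComm.comb {D : H →ₗ.[ℂ] H} {x x' c y y' d : H →L[ℂ] H} (z : ℂ)
    (h : IsGradedComm D x x' c) (h' : IsGradedComm D y y' d) :
    IsGradedComm D (z • x + y) (z • x' + y') (z • c + d) := by
  intro e f hef
  have := D.graph.add_mem (D.graph.smul_mem z (h e f hef)) (h' e f hef)
  convert this using 1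
  ext <;> simp
  abel

lemma IsGradedComm.gradedComm_eq {D : H →ₗ.[ℂ] H} (hD : Dense (D.domain : Set H))
    {x x' c : H →L[ℂ] H} (h : IsGradedComm D x x' c) : gradedComm D x x' = c := by
  have hex : ∃ c, IsGradedComm D x x' c := ⟨c, h⟩
  have h1 : gradedComm D x x' = hex.choose := dif_pos hex
  rw [h1]
  have h2 := hex.choose_spec
  apply ContinuousLinearMap.coeFn_injective
  refine Continuous.ext_on hD (map_continuous _) (map_continuous _) ?_
  intro e he
  have h3 := h2 e _ (D.mem_graph ⟨e, he⟩)
  have h4 := h e _ (D.mem_graph ⟨e, he⟩)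
  exact add_left_cancel (D.mem_graph_snd_inj h3 h4 rfl)

lemma gradedComm_comb {D : H →ₗ.[ℂ] H} (hD : Dense (D.domain : Set H))
    {x x' y y' : H →L[ℂ] H} (z : ℂ)
    (h : ∃ c, IsGradedComm D x x' c) (h' : ∃ c, IsGradedComm D y y' c) :
    gradedComm D (z • x + y) (z • x' + y') = z • gradedComm D x x' + gradedComm D y y' := by
  obtain ⟨c, hc⟩ := h
  obtain ⟨d, hd⟩ := h'
  rw [(hc.comb z hd).gradedComm_eq hD, hc.gradedComm_eq hD, hd.gradedComm_eq hD]

end Hilbert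

/-! ### Spectral triples and their Sobolev algebras -/

/-- Index set of the `2ⁿ` summands of `H ⊕ ⋯ ⊕ H`. -/
def Idx : ℕ → Type
  | 0 => Unit
  | n + 1 => Idx n ⊕ Idx n

instance instFintypeIdx : ∀ n, Fintype (Idx n)
  | 0 => inferInstanceAs (Fintype Unit)
  | n + 1 => @instFintypeSum _ _ (instFintypeIdx n) (instFintypeIdx n)

instance instDecidableEqIdx : ∀ n, DecidableEq (Idx n)
  | 0 => inferInstanceAs (DecidableEq Unit)
  | n + 1 => @instDecidableEqSum _ _ (instDecidableEqIdx n) (instDecidableEqIdx n)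

/-- The data of a spectral triple over a `ℤ/2`-graded C⋆-algebra `B` (with grading automorphism
`γ`): a graded Hilbert space `H` (with grading operator `Γ`), a graded representation `ρ` of `B` on
`H`, and an odd selfadjoint operator `D`. -/
structure SpectralData (B H : Type*) [NonUnitalCStarAlgebra B]
    [NormedAddCommGroup H] [InnerProductSpace ℂ H] [CompleteSpace H] where
  γ : B ≃⋆ₐ[ℂ] B
  γ_γ : ∀ b, γ (γ b) = b
  Γ : H →L[ℂ] H
  Γ_selfAdjoint : IsSelfAdjoint Γ
  Γ_mul_Γ : Γ * Γ = 1
  ρ : B →⋆ₙₐ[ℂ] (H →L[ℂ] H)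
  ρ_γ : ∀ b, ρ (γ b) = Γ * ρ b * Γ
  D : H →ₗ.[ℂ] H
  D_selfAdjoint : IsSelfAdjoint D
  D_odd : ∀ e f, (e, f) ∈ D.graph → (Γ e, -Γ f) ∈ D.graph

namespace SpectralData

variable {B H : Type*} [NonUnitalCStarAlgebra B]
  [NormedAddCommGroup H] [InnerProductSpace ℂ H] [CompleteSpace H] (S : SpectralData B H)

/-- Bounded operators on the `2ⁿ`-fold sum of `H`, as operator matrices. -/
abbrev Op (H : Type*) [NormedAddCommGroup H] [InnerProductSpace ℂ H] (n : ℕ) : Type _ :=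
  Matrix (Idx n) (Idx n) (H →L[ℂ] H)

/-- The operator matrix `[a, b; c, d]`. -/
def block {n : ℕ} (a b c d : Op H n) : Op H (n + 1) := Matrix.fromBlocks a b c d

lemma block_comb {n : ℕ} (z : ℂ) (a b c d a' b' c' d' : Op H n) :
    block (z • a + a') (z • b + b') (z • c + c') (z • d + d')
      = z • block a b c d + block a' b' c' d' := by
  ext1 i j
  rcases i with i | i <;> rcases j with j | j <;> rfl

/-- The Woronowicz projection of the diagonal operator `D ⊕ ⋯ ⊕ D` on the `2ⁿ`-fold sum of `H`;
it acts on the `2ⁿ⁺¹`-fold sum. -/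
def wor (n : ℕ) : Op H (n + 1) :=
  let R := invOneAddSq S.D
  let Q := bddComp S.D R
  let T := bddComp S.D Q
  block (Matrix.diagonal fun _ => R) (Matrix.diagonal fun _ => Q)
    (Matrix.diagonal fun _ => Q) (Matrix.diagonal fun _ => T)

/-- The product `p_n ⋯ p_1` of the (mutually commuting, diagonally amplified) Woronowicz
projections: the projection of the `2ⁿ`-fold sum of `H` onto the Sobolev space `𝔊(D_n)`. -/
def projPos : (n : ℕ) → Op H n
  | 0 => 1
  | n + 1 => S.wor n * block (projPos n) 0 0 (projPos n)

/-- The product `p_n^⊥ ⋯ p_1^⊥` of the complementary projections. -/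
def projNeg : (n : ℕ) → Op H n
  | 0 => 1
  | n + 1 => (1 - S.wor n) * block (projNeg n) 0 0 (projNeg n)

/-- The graded commutator with the diagonal operator `D ⊕ ⋯ ⊕ D`. -/
def commMat {n : ℕ} (x x' : Op H n) : Op H n :=
  Matrix.of fun i j => gradedComm S.D (x i j) (x' i j)

/-- The matrix `[x, 0; [D, x], x']`. -/
def lowerTri {n : ℕ} (x x' : Op H n) : Op H (n + 1) :=
  block x 0 (S.commMat x x') x'

/-- The maps `θ_n`: `θ_0 = ρ`, and
`θ_{n+1}(b) = p_{n+1} ⋯ p_1 π_{n+1}(b) p_1 ⋯ p_{n+1}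
  + p_{n+1}^⊥ ⋯ p_1^⊥ π_{n+1}(b) p_1^⊥ ⋯ p_{n+1}^⊥`.
They are meaningful on the Sobolev algebra `𝓑_n` only. For homogeneous `b`, `(-1)^{∂b} θ_n(b)` is
`θ_n(γ b)`. -/
def θ : (n : ℕ) → B → Op H n
  | 0, b => fun _ _ => S.ρ b
  | n + 1, b =>
    S.projPos (n + 1) * S.lowerTri (θ n b) (θ n (S.γ b)) * S.projPos (n + 1)
      + S.projNeg (n + 1) * S.lowerTri (θ n b) (θ n (S.γ b)) * S.projNeg (n + 1)

/-- The representations `π_n`: `π_0 = ρ`, and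
`π_{n+1}(b) = [θ_n(b), 0; [D, θ_n(b)], (-1)^{∂b} θ_n(b)]`, for `b ∈ 𝓑_{n+1}`. -/
def π : (n : ℕ) → B → Op H n
  | 0, b => fun _ _ => S.ρ b
  | n + 1, b => S.lowerTri (S.θ n b) (S.θ n (S.γ b))

/-- Membership in the Sobolev algebras: `𝓑_0 = B`, and `𝓑_{n+1}` consists of the `b ∈ 𝓑_n` such
that `[D, θ_n(b)]` is bounded; the condition is imposed on the homogeneous components of `b`, that
is, on `b` and `γ b`. -/
def InSobolev : ℕ → B → Prop
  | 0, _ => True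
  | n + 1, b => InSobolev n b ∧ ∀ i j,
      (∃ c, IsGradedComm S.D (S.θ n b i j) (S.θ n (S.γ b) i j) c) ∧
      (∃ c, IsGradedComm S.D (S.θ n (S.γ b) i j) (S.θ n b i j) c)

variable {S}

lemma InSobolev.γ {n : ℕ} {b : B} (h : S.InSobolev n b) : S.InSobolev n (S.γ b) := by
  induction n with
  | zero => trivial
  | succ n ih =>
    refine ⟨ih h.1, fun i j => ?_⟩
    rw [S.γ_γ]
    exact ⟨(h.2 i j).2, (h.2 i j).1⟩

lemma lowerTri_comb {n : ℕ} {x x' y y' : Op H n} (z : ℂ)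
    (h : ∀ i j, ∃ c, IsGradedComm S.D (x i j) (x' i j) c)
    (h' : ∀ i j, ∃ c, IsGradedComm S.D (y i j) (y' i j) c) :
    S.lowerTri (z • x + y) (z • x' + y') = z • S.lowerTri x x' + S.lowerTri y y' := by
  have hc : S.commMat (z • x + y) (z • x' + y') = z • S.commMat x x' + S.commMat y y' := by
    ext1 i j
    exact gradedComm_comb S.D_selfAdjoint.dense_domain z (h i j) (h' i j)
  rw [lowerTri, lowerTri, lowerTri, hc, ← block_comb]
  simp

lemma θ_comb {n : ℕ} {a b : B} (z : ℂ) (ha : S.InSobolev n a) (hb : S.InSobolev n b) :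
    S.θ n (z • a + b) = z • S.θ n a + S.θ n b := by
  induction n generalizing a b with
  | zero =>
    ext1 i j
    change S.ρ (z • a + b) = z • S.ρ a + S.ρ b
    simp
  | succ n ih =>
    have h1 := ih ha.1 hb.1
    have h2 : S.θ n (S.γ (z • a + b)) = z • S.θ n (S.γ a) + S.θ n (S.γ b) := by
      rw [map_add, map_smul, ih ha.1.γ hb.1.γ]
    simp only [θ]
    rw [h1, h2, lowerTri_comb z (fun i j => (ha.2 i j).1) (fun i j => (hb.2 i j).1)]
    simp only [mul_add, add_mul, mul_smul_comm, smul_mul_assoc, smul_add]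
    abel

lemma π_comb {n : ℕ} {a b : B} (z : ℂ) (ha : S.InSobolev n a) (hb : S.InSobolev n b) :
    S.π n (z • a + b) = z • S.π n a + S.π n b := by
  cases n with
  | zero =>
    ext1 i j
    change S.ρ (z • a + b) = z • S.ρ a + S.ρ b
    simp
  | succ n =>
    have h2 : S.θ n (S.γ (z • a + b)) = z • S.θ n (S.γ a) + S.θ n (S.γ b) := by
      rw [map_add, map_smul, θ_comb z ha.1.γ hb.1.γ]
    simp only [π]
    rw [θ_comb z ha.1 hb.1, h2,
      lowerTri_comb z (fun i j => (ha.2 i j).1) (fun i j => (hb.2 i j).1)]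

lemma InSobolev.comb {n : ℕ} {a b : B} (z : ℂ) (ha : S.InSobolev n a) (hb : S.InSobolev n b) :
    S.InSobolev n (z • a + b) := by
  induction n with
  | zero => trivial
  | succ n ih =>
    have h2 : S.θ n (S.γ (z • a + b)) = z • S.θ n (S.γ a) + S.θ n (S.γ b) := by
      rw [map_add, map_smul, θ_comb z ha.1.γ hb.1.γ]
    refine ⟨ih ha.1 hb.1, fun i j => ?_⟩
    rw [θ_comb z ha.1 hb.1, h2]
    obtain ⟨⟨c, hc⟩, ⟨c', hc'⟩⟩ := ha.2 i j
    obtain ⟨⟨d, hd⟩, ⟨d', hd'⟩⟩ := hb.2 i j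
    exact ⟨⟨_, hc.comb z hd⟩, ⟨_, hc'.comb z hd'⟩⟩

lemma θ_zero (n : ℕ) (h : S.InSobolev n 0) : S.θ n 0 = 0 := by
  have := θ_comb (S := S) (-1) h h
  simpa using this

lemma InSobolev.zero (n : ℕ) : S.InSobolev n 0 := by
  induction n with
  | zero => trivial
  | succ n ih =>
    refine ⟨ih, fun i j => ?_⟩
    have h0 : IsGradedComm S.D 0 0 0 := by
      intro e f _
      simp
    rw [map_zero, θ_zero n ih]
    exact ⟨⟨0, h0⟩, ⟨0, h0⟩⟩

lemma InSobolev.mono {m n : ℕ} (hmn : m ≤ n) {b : B} (h : S.InSobolev n b) : S.InSobolev m b := by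
  induction n, hmn using Nat.le_induction with
  | base => exact h
  | succ n _ ih => exact ih h.1

variable (S)

/-- The `n`-th Sobolev subalgebra `𝓑_n` of `B`, as a subspace. -/
def sobolev (n : ℕ) : Submodule ℂ B where
  carrier := {b | S.InSobolev n b}
  zero_mem' := InSobolev.zero n
  add_mem' {a b} ha hb := by simpa using InSobolev.comb 1 ha hb
  smul_mem' z a ha := by simpa using InSobolev.comb z ha (InSobolev.zero n)

/-- The data form a spectral triple: `b (1 + D²)⁻¹` is compact for all `b ∈ B`, and `𝓑_1` is dense
in `B`. -/
structure IsSpectralTriple : Prop where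
  compact : ∀ b, IsCompactOperator (S.ρ b * invOneAddSq S.D)
  dense : Dense (S.sobolev 1 : Set B)

/-- The spectral triple is `C^k`, so that `B` with this spectral triple is a `C^k`-algebra. -/
structure IsCk (k : ℕ) : Prop extends S.IsSpectralTriple where
  dense_sobolev : Dense (S.sobolev k : Set B)

/-- The entrywise application of `π_j` to a matrix over `B`. -/
def amp (j : ℕ) {m l : Type*} (M : Matrix m l B) :
    Matrix (m × Idx j) (l × Idx j) (H →L[ℂ] H) :=
  Matrix.of fun r s => S.π j (M r.1 s.1) r.2 s.2

variable [PartialOrder B] [StarOrderedRing B]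

/-- The `k`-norm of a matrix over `𝓑_k`: the operator norm in the representation
`⨁_{j ≤ k} π_j`. The C⋆-norm of the matrix over `B` is included, which changes nothing if
`π_0 = ρ` is faithful, and makes this a norm in general. -/
def kNorm (k : ℕ) {m l : Type*} [Fintype m] [Fintype l] (M : Matrix m l B) : ℝ :=
  max ‖CStarMatrix.ofMatrix M‖ (⨆ j : Fin (k + 1), ‖CStarMatrix.ofMatrix (S.amp j M)‖)

variable {S}

lemma kNorm_comb_le {k : ℕ} {m l : Type*} [Fintype m] [Fintype l] {M N : Matrix m l B} (z : ℂ)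
    (hM : ∀ i j, S.InSobolev k (M i j)) (hN : ∀ i j, S.InSobolev k (N i j)) :
    S.kNorm k (z • M + N) ≤ ‖z‖ * S.kNorm k M + S.kNorm k N := by
  have hb : ∀ P : Matrix m l B, ∀ j : Fin (k + 1),
      ‖CStarMatrix.ofMatrix (S.amp j P)‖ ≤ S.kNorm k P := fun P j =>
    (le_ciSup (f := fun j : Fin (k + 1) => ‖CStarMatrix.ofMatrix (S.amp j P)‖)
      (Set.finite_range _).bddAbove j).trans (le_max_right _ _)
  refine max_le ?_ (ciSup_le fun j => ?_)
  · have : CStarMatrix.ofMatrix (z • M + N)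
      = z • CStarMatrix.ofMatrix M + CStarMatrix.ofMatrix N := rfl
    rw [this]
    refine (norm_add_le _ _).trans ?_
    rw [norm_smul]
    gcongr <;> exact le_max_left _ _
  · have h1 : S.amp j (z • M + N) = z • S.amp j M + S.amp j N := by
      ext1 r s
      have hj : (j : ℕ) ≤ k := Nat.lt_succ_iff.mp j.2
      have := π_comb (n := j) z ((hM r.1 s.1).mono hj) ((hN r.1 s.1).mono hj)
      exact congrFun (congrFun this r.2) s.2
    have : CStarMatrix.ofMatrix (S.amp j (z • M + N))
      = z • CStarMatrix.ofMatrix (S.amp j M) + CStarMatrix.ofMatrix (S.amp j N) := by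
      rw [h1]; rfl
    rw [this]
    refine (norm_add_le _ _).trans ?_
    rw [norm_smul]
    gcongr <;> exact hb _ j

lemma kNorm_nonneg {k : ℕ} {m l : Type*} [Fintype m] [Fintype l] (M : Matrix m l B) :
    0 ≤ S.kNorm k M := (norm_nonneg _).trans (le_max_left _ _)

end SpectralData

/-! ### `C^k`-modules

A right C⋆-module over `B` is a `CStarModule` over `Bᵐᵒᵖ`, the right action of `b` on `e` being
`op b • e`. -/

section Modules

variable (B : Type*) {H E : Type*} [NonUnitalCStarAlgebra B] [PartialOrder B] [StarOrderedRing B]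
  [NormedAddCommGroup H] [InnerProductSpace ℂ H] [CompleteSpace H]
  [NormedAddCommGroup E] [NormedSpace ℂ E] [SMul Bᵐᵒᵖ E] [CStarModule Bᵐᵒᵖ E]

/-- The `B`-valued inner product of a right C⋆-module: conjugate linear in the first variable,
with `⟨e, f b⟩ = ⟨e, f⟩ b`. -/
def ip (e f : E) : B := MulOpposite.unop (inner Bᵐᵒᵖ e f)

variable (E) in
/-- The compact endomorphisms `𝕂_B(E)`: the closed span of the operators `g ↦ e ⟨f, g⟩`. -/
def compactEnd : Set (E →L[ℂ] E) :=
  closure (Submodule.span ℂ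
    {T : E →L[ℂ] E | ∃ e f : E, ∀ g, T g = MulOpposite.op (ip B f g) • e} : Set (E →L[ℂ] E))

variable {B}

lemma ip_comb (z : ℂ) (x e f : E) : ip B x (z • e + f) = z • ip B x e + ip B x f := by
  simp [ip]

/-- The indices `1 ≤ |i| ≤ n`. -/
abbrev signedIdx (n : ℕ) : Finset ℤ := (Finset.Icc (-n : ℤ) n).erase 0

/-- The vectors `x_i`, `i ∈ ℤ ∖ {0}`, make `E` a `C^k`-module: the operators
`u_n = ∑_{1 ≤ |i| ≤ n} x_i ⊗ x_i` form an approximate unit of `𝕂_B(E)`, and the infinite matrix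
`(⟨x_i, x_j⟩)` has finite `k`-norm. -/
structure IsCkFrame (S : SpectralData B H) (k : ℕ) (x : ℤ → E) : Prop where
  approx_unit : ∃ u : ℕ → E →L[ℂ] E,
    (∀ n e, u n e = ∑ i ∈ signedIdx n, MulOpposite.op (ip B (x i) e) • x i) ∧
    ∀ T ∈ compactEnd B E,
      Filter.Tendsto (fun n => u n * T) Filter.atTop (nhds T) ∧
      Filter.Tendsto (fun n => T * u n) Filter.atTop (nhds T)
  mem : ∀ i j, i ≠ 0 → j ≠ 0 → ip B (x i) (x j) ∈ S.sobolev k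
  bounded : ∃ C : ℝ, ∀ n,
    S.kNorm k (Matrix.of fun i j : signedIdx n => ip B (x i) (x j)) ≤ C

/-- The column `∑_{1 ≤ |i| ≤ n} e_i ⟨x_i, e⟩`. -/
def column (x : ℤ → E) (n : ℕ) (e : E) : Matrix (signedIdx n) Unit B :=
  Matrix.of fun i _ => ip B (x i) e

lemma column_comb (x : ℤ → E) (n : ℕ) (z : ℂ) (e f : E) :
    column (B := B) x n (z • e + f) = z • column x n e + column x n f := by
  ext i j
  exact ip_comb z _ _ _

lemma kNorm_column_comb_le {S : SpectralData B H} {k : ℕ} {x : ℤ → E} {e f : E} (z : ℂ)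
    (he : ∀ i, i ≠ 0 → ip B (x i) e ∈ S.sobolev k)
    (hf : ∀ i, i ≠ 0 → ip B (x i) f ∈ S.sobolev k) (n : ℕ) :
    S.kNorm k (column x n (z • e + f))
      ≤ ‖z‖ * S.kNorm k (column x n e) + S.kNorm k (column x n f) := by
  rw [column_comb]
  exact SpectralData.kNorm_comb_le z (fun i _ => he i (Finset.ne_of_mem_erase i.2))
    (fun i _ => hf i (Finset.ne_of_mem_erase i.2))

lemma kNorm_column_zero (S : SpectralData B H) (k : ℕ) (x : ℤ → E) (n : ℕ) :
    S.kNorm k (column x n 0) = 0 := by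
  have hx : ∀ i, i ≠ 0 → ip B (x i) (0 : E) ∈ S.sobolev k := by
    intro i _
    have : ip B (x i) (0 : E) = 0 := by simp [ip]
    rw [this]
    exact Submodule.zero_mem _
  have h0 : column (B := B) x n 0 = 0 := by
    ext i j
    simp [column, ip]
  have hamp : ∀ j : Fin (k + 1), S.amp j (column (B := B) x n 0) = 0 := by
    intro j
    have hπ : S.π j 0 = 0 := by
      have := SpectralData.π_comb (S := S) (n := j) (-1) (SpectralData.InSobolev.zero _)
        (SpectralData.InSobolev.zero _)
      simpa using this
    rw [h0]
    ext1 r s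
    exact congrFun (congrFun hπ r.2) s.2
  have h1 : ‖CStarMatrix.ofMatrix (column (B := B) x n 0)‖ = 0 := by
    rw [h0]; exact norm_zero
  have h2 : ∀ j : Fin (k + 1), ‖CStarMatrix.ofMatrix (S.amp j (column (B := B) x n 0))‖ = 0 := by
    intro j
    rw [hamp]; exact norm_zero
  simp [SpectralData.kNorm, h1, h2]

/-- The subspace
`E^k = {e : ⟨x_i, e⟩ ∈ 𝓑_k, sup_n ‖∑_{1 ≤ |i| ≤ n} e_i ⟨x_i, e⟩‖_k < ∞}` of `E`. -/
def ckSubmodule (S : SpectralData B H) (k : ℕ) (x : ℤ → E) : Submodule ℂ E where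
  carrier := {e | (∀ i, i ≠ 0 → ip B (x i) e ∈ S.sobolev k) ∧
    BddAbove (Set.range fun n => S.kNorm k (column x n e))}
  zero_mem' := by
    refine ⟨fun i _ => ?_, ⟨0, ?_⟩⟩
    · have : ip B (x i) (0 : E) = 0 := by simp [ip]
      rw [this]
      exact Submodule.zero_mem _
    · rintro _ ⟨n, rfl⟩
      exact (kNorm_column_zero S k x n).le
  add_mem' {e f} he hf := by
    obtain ⟨he, C, hC⟩ := he
    obtain ⟨hf, C', hC'⟩ := hf
    refine ⟨fun i hi => ?_, ⟨C + C', ?_⟩⟩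
    · have := ip_comb (B := B) 1 (x i) e f
      simp only [one_smul] at this
      rw [this]
      exact Submodule.add_mem _ (he i hi) (hf i hi)
    · rintro _ ⟨n, rfl⟩
      have := kNorm_column_comb_le 1 he hf n
      simp only [one_smul, norm_one, one_mul] at this
      exact this.trans (add_le_add (hC ⟨n, rfl⟩) (hC' ⟨n, rfl⟩))
  smul_mem' z e he := by
    obtain ⟨he, C, hC⟩ := he
    have h0 : ∀ i, i ≠ 0 → ip B (x i) (0 : E) ∈ S.sobolev k := by
      intro i _
      have : ip B (x i) (0 : E) = 0 := by simp [ip]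
      rw [this]
      exact Submodule.zero_mem _
    refine ⟨fun i hi => ?_, ⟨‖z‖ * C, ?_⟩⟩
    · have : ip B (x i) (z • e) = z • ip B (x i) e := by simp [ip]
      rw [this]
      exact Submodule.smul_mem _ _ (he i hi)
    · rintro _ ⟨n, rfl⟩
      have := kNorm_column_comb_le z he h0 n
      rw [kNorm_column_zero, add_zero, add_zero] at this
      exact this.trans (mul_le_mul_of_nonneg_left (hC ⟨n, rfl⟩) (norm_nonneg z))

/-- The space `E^k`; its topology is given by the norm
`‖e‖ = sup_n ‖∑_{1 ≤ |i| ≤ n} e_i ⟨x_i, e⟩‖_k`, not by the norm of `E`. -/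
def Ck (S : SpectralData B H) (k : ℕ) (x : ℤ → E) : Type _ := ckSubmodule S k x

namespace Ck

variable {S : SpectralData B H} {k : ℕ} {x : ℤ → E}

instance : AddCommGroup (Ck S k x) := inferInstanceAs (AddCommGroup (ckSubmodule S k x))
instance : Module ℂ (Ck S k x) := inferInstanceAs (Module ℂ (ckSubmodule S k x))

/-- The inclusion `E^k → E`. -/
def incl : Ck S k x →ₗ[ℂ] E := (ckSubmodule S k x).subtype

/-- The norm of `E^k`. -/
def ckNorm : AddGroupSeminorm (Ck S k x) where
  toFun e := ⨆ n, S.kNorm k (column x n (incl e))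
  map_zero' := by simp [kNorm_column_zero]
  add_le' e f := by
    refine ciSup_le fun n => ?_
    have := kNorm_column_comb_le 1 (x := x) e.2.1 f.2.1 n
    simp only [one_smul, norm_one, one_mul] at this
    exact this.trans (add_le_add (le_ciSup e.2.2 n) (le_ciSup f.2.2 n))
  neg' e := by
    have key : ∀ e : Ck S k x, ∀ n,
        S.kNorm k (column x n (incl (-e))) ≤ S.kNorm k (column x n (incl e)) := by
      intro e n
      have := kNorm_column_comb_le (-1) (x := x) e.2.1 (0 : ckSubmodule S k x).2.1 n
      rw [Submodule.coe_zero, kNorm_column_zero, add_zero, add_zero, norm_neg, norm_one, one_mul,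
        neg_one_smul] at this
      rw [map_neg]
      exact this
    congr 1
    ext n
    refine le_antisymm (key e n) ?_
    have := key (-e) n
    rwa [neg_neg] at this

instance : SeminormedAddCommGroup (Ck S k x) := ckNorm.toSeminormedAddCommGroup

/-- The inner product of `E^k`, the restriction of that of `E`. -/
def inner (e f : Ck S k x) : B := ip B (incl e) (incl f)

/-- The inner product of `E^k ⊕ E^k`. -/
def inner₂ (u w : Ck S k x × Ck S k x) : B := inner u.1 w.1 + inner u.2 w.2

/-- A selfadjoint regular operator in `E^k`: it is closed and densely defined, it is symmetric and
has the same domain as its adjoint, and `D + i`, `D - i` map `Dom D` onto `E^k`. -/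
structure IsSelfAdjointRegular (D : Ck S k x →ₗ.[ℂ] Ck S k x) : Prop where
  closed : D.IsClosed
  dense : Dense (D.domain : Set (Ck S k x))
  symmetric : ∀ e f : D.domain, inner (D e) (f : Ck S k x) = inner (e : Ck S k x) (D f)
  adjoint_domain : ∀ e, e ∈ D.domain ↔ ∃ g, ∀ f : D.domain, inner e (D f) = inner g (f : Ck S k x)
  range_add : ∀ y, ∃ e : D.domain, D e + Complex.I • (e : Ck S k x) = y
  range_sub : ∀ y, ∃ e : D.domain, D e - Complex.I • (e : Ck S k x) = y

/-- `T'` is an adjoint of the operator `T` on `E^k ⊕ E^k`. -/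
def IsAdjoint₂ (T T' : Ck S k x × Ck S k x → Ck S k x × Ck S k x) : Prop :=
  ∀ u w, inner₂ (T u) w = inner₂ u (T' w)

/-- `End*(E^k ⊕ E^k)`: the operators on `E^k ⊕ E^k` that have an adjoint. -/
def EndStar₂ (S : SpectralData B H) (k : ℕ) (x : ℤ → E) :
    Set (Ck S k x × Ck S k x → Ck S k x × Ck S k x) :=
  {T | ∃ T', IsAdjoint₂ T T'}

end Ck

end Modules

end

end NCG

namespace NCG

/-! ### The graph of an operator, its rotation, and the matrix of the projection between them -/

section PartialOperators

variable {X : Type*} [AddCommGroup X] [Module ℂ X]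

/-! Write `G` for the graph of `D` and `v` for the rotation `(x, y) ↦ (-y, x)`. The theorem amounts
to the decomposition of `E^k ⊕ E^k` into `G` and `v G`, and the argument is algebraic.

Orthogonality is symmetry of `D`: `⟨(e, De), (-Df, f)⟩ = ⟨De, f⟩ - ⟨e, Df⟩ = 0`. A vector in both
subspaces is orthogonal to itself, hence zero, because the `B`-valued inner product inherited from
`E` is definite. The two subspaces span because solving `(x, y) = (e, De) + v (f, Df)` is equivalent
to solving `(D - i) a = y - i x` and `(D + i) b = y + i x` with `a = e + i f` and `b = e - i f`;
both are solvable since `D ± i` are onto (`graph_sup_map_vMap_eq_top`).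

Let `p` be the projection onto `G` along `v G`. Its range is `G`, and it is selfadjoint since the
decomposition is orthogonal (`isAdjoint₂_projection`). If `p (x, 0) = (e, f)`, then `f = De` and `Df
= x - e`, so `e` is the unique solution of `(1 + D²) e = x`. This yields bijectivity of `1 + D²` and
the first column of `p_D`; the second column follows by rotation (`isWoronowiczMatrix_projection`).
-/

@[simp]
lemma vMap_apply (x y : X) : vMap X (x, y) = (-y, x) := rfl

lemma vMap_bijective : Function.Bijective (vMap X) := by
  refine ⟨fun u w h => ?_, fun u => ⟨(u.2, -u.1), by simp⟩⟩
  have h1 := congrArg Prod.fst h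
  have h2 := congrArg Prod.snd h
  exact Prod.ext h2 (neg_injective h1)

/-- Apply `v⁻¹ : (x, y) ↦ (y, -x)`. This turns membership in the rotated graph into an equation for
`D`. -/
lemma mem_map_vMap_graph_iff {D : X →ₗ.[ℂ] X} {x y : X} :
    (x, y) ∈ D.graph.map (vMap X) ↔ (y, -x) ∈ D.graph := by
  constructor
  · rintro ⟨⟨a, b⟩, hab, h⟩
    rw [vMap_apply, Prod.mk.injEq] at h
    obtain ⟨rfl, rfl⟩ := h
    simpa using hab
  · exact fun h => ⟨_, h, by simp⟩

/-- If `D + i` and `D - i` are onto, the graph of `D` and its rotation span `X ⊕ X`. -/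
lemma graph_sup_map_vMap_eq_top {D : X →ₗ.[ℂ] X}
    (hadd : ∀ y, ∃ e : D.domain, D e + Complex.I • (e : X) = y)
    (hsub : ∀ y, ∃ e : D.domain, D e - Complex.I • (e : X) = y) :
    D.graph ⊔ D.graph.map (vMap X) = ⊤ := by
  refine eq_top_iff.2 ?_
  rintro ⟨x, y⟩ -
  -- The right-hand sides are `y - i x` here and `y + i x` in the next line.
  obtain ⟨a, ha⟩ := hsub (-Complex.I • (x + Complex.I • y))
  obtain ⟨b, hb⟩ := hadd (Complex.I • (x - Complex.I • y))
  have ha' := D.mem_graph a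
  have hb' := D.mem_graph b
  have hI : Complex.I * Complex.I = -1 := Complex.I_mul_I
  have ea : D a = Complex.I • (a : X) - Complex.I • x + y := by
    rw [eq_add_of_sub_eq ha]
    match_scalars <;> grind
  have eb : D b = -Complex.I • (b : X) + Complex.I • x + y := by
    rw [eq_sub_of_add_eq hb]
    match_scalars <;> grind
  rw [ea] at ha'
  rw [eb] at hb'
  -- Recover `e = (a + b) / 2` and `f = -i (a - b) / 2` from `a = e + i f` and `b = e - i f`.
  have h1 := D.graph.smul_mem (1 / 2 : ℂ) (D.graph.add_mem ha' hb')
  have h2 := D.graph.smul_mem (-Complex.I / 2) (D.graph.sub_mem ha' hb')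
  refine Submodule.mem_sup.2 ⟨_, h1, _, Submodule.mem_map_of_mem h2, ?_⟩
  ext
  · simp only [Prod.smul_mk, Prod.mk_add_mk, Prod.mk_sub_mk, vMap_apply]
    match_scalars <;> grind
  · simp only [Prod.smul_mk, Prod.mk_add_mk, Prod.mk_sub_mk, vMap_apply]
    match_scalars <;> ring

/-- The projection onto the graph of `D` along its rotation is the Woronowicz matrix of `D`. -/
lemma isWoronowiczMatrix_projection {D : X →ₗ.[ℂ] X}
    (h : IsCompl D.graph (D.graph.map (vMap X))) :
    IsWoronowiczMatrix D (Submodule.projection _ _ h) := by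
  set p := Submodule.projection _ _ h with hp
  have hmem : ∀ u, p u ∈ D.graph := Submodule.projection_apply_mem h
  have hsub : ∀ x y, (y - (p (x, y)).2, (p (x, y)).1 - x) ∈ D.graph := by
    intro x y
    have := Submodule.sub_projection_mem h (x, y)
    rw [← hp, show (x, y) - p (x, y) = (x - (p (x, y)).1, y - (p (x, y)).2) from rfl,
      mem_map_vMap_graph_iff] at this
    simpa using this
  -- A point `(a, b)` of the graph whose remainder `(x - a, y - b)` lies in the rotated graph must
  -- be `p (x, y)`. Both columns of `p` are identified through this criterion.
  have huniq : ∀ {a b x y}, (a, b) ∈ D.graph → (y - b, a - x) ∈ D.graph → p (x, y) = (a, b) := by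
    intro a b x y hab hxy
    have h1 : (x - a, y - b) ∈ D.graph.map (vMap X) := by
      rw [mem_map_vMap_graph_iff]
      simpa using hxy
    have h2 : (x, y) = (a, b) + (x - a, y - b) := by simp
    rw [h2, map_add, hp, Submodule.projection_apply_left h ⟨_, hab⟩,
      (Submodule.projection_apply_eq_zero_iff h).2 h1, add_zero]
  let R : X →ₗ[ℂ] X := LinearMap.fst ℂ X X ∘ₗ p ∘ₗ LinearMap.inl ℂ X X
  let Q : X →ₗ[ℂ] X := LinearMap.snd ℂ X X ∘ₗ p ∘ₗ LinearMap.inl ℂ X X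
  have hRQ : ∀ x, (R x, Q x) ∈ D.graph := fun x => hmem (x, 0)
  have hQT : ∀ x, (Q x, x - R x) ∈ D.graph := by
    intro x
    have := D.graph.neg_mem (hsub x 0)
    simpa [R, Q] using this
  -- The lower right entry is `1 - R`, since `R + D² R = 1`.
  refine ⟨R, Q, LinearMap.id - R, fun x e => ⟨?_, ?_⟩, hRQ, fun x => hQT x, fun x y => ?_⟩
  · rintro rfl
    exact ⟨Q x, x - R x, hRQ x, hQT x, by simp⟩
  · rintro ⟨f, g, hef, hfg, rfl⟩
    have h1 : p (e + g, 0) = (e, f) := huniq hef (by simpa using D.graph.neg_mem hfg)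
    exact congrArg Prod.fst h1
  -- Since `v² = -1`, the rotation exchanges the two summands, so `p v = v (1 - p)`. Evaluating at
  -- `(y, 0)` predicts this value.
  · have h1 : p (0, y) = (Q y, y - R y) := huniq (hQT y) (by simpa using hRQ y)
    have h2 : (x, y) = (x, 0) + (0, y) := by simp
    rw [h2, map_add, h1]
    rfl

end PartialOperators

/-! ### Orthogonality for the `B`-valued inner product on `E^k ⊕ E^k` -/

namespace Ck

variable {B H E : Type*} [NonUnitalCStarAlgebra B] [PartialOrder B] [StarOrderedRing B]
  [NormedAddCommGroup H] [InnerProductSpace ℂ H] [CompleteSpace H]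
  [NormedAddCommGroup E] [NormedSpace ℂ E] [SMul Bᵐᵒᵖ E] [CStarModule Bᵐᵒᵖ E]
  {S : SpectralData B H} {k : ℕ} {x : ℤ → E}

lemma inner_neg_left (e f : Ck S k x) : inner (-e) f = -inner e f := by
  simp [inner, ip]

lemma inner_neg_right (e f : Ck S k x) : inner e (-f) = -inner e f := by
  simp [inner, ip]

lemma inner_self_nonneg (e : Ck S k x) : 0 ≤ inner e e :=
  MulOpposite.unop_nonneg.2 CStarModule.inner_self_nonneg

lemma inner_self_eq_zero {e : Ck S k x} : inner e e = 0 ↔ e = 0 := by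
  rw [inner, ip, MulOpposite.unop_eq_zero_iff, CStarModule.inner_self]
  exact Submodule.coe_eq_zero (p := ckSubmodule S k x)

lemma inner₂_add_left (u v w : Ck S k x × Ck S k x) :
    inner₂ (u + v) w = inner₂ u w + inner₂ v w := by
  simp [inner₂, inner, ip]
  abel

lemma inner₂_add_right (u v w : Ck S k x × Ck S k x) :
    inner₂ u (v + w) = inner₂ u v + inner₂ u w := by
  simp [inner₂, inner, ip]
  abel

lemma star_inner₂ (u w : Ck S k x × Ck S k x) : star (inner₂ u w) = inner₂ w u := by
  simp only [inner₂, inner, ip, star_add, ← MulOpposite.unop_star, CStarModule.star_inner]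

/-- Two positive elements of `B` with sum zero both vanish, and the inner product of `E` is
definite. -/
lemma eq_zero_of_inner₂_self {u : Ck S k x × Ck S k x} (h : inner₂ u u = 0) : u = 0 := by
  have h' := (add_eq_zero_iff_of_nonneg (inner_self_nonneg u.1) (inner_self_nonneg u.2)).1 h
  exact Prod.ext (inner_self_eq_zero.1 h'.1) (inner_self_eq_zero.1 h'.2)

lemma inner₂_vMap_vMap (u w : Ck S k x × Ck S k x) :
    inner₂ (vMap _ u) (vMap _ w) = inner₂ u w := by
  obtain ⟨a, b⟩ := u
  obtain ⟨c, d⟩ := w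
  simp [inner₂, inner_neg_left, inner_neg_right, add_comm]

lemma vMap_mem_endStar₂ : (vMap (Ck S k x) : _ → _) ∈ EndStar₂ S k x := by
  -- The adjoint is `v⁻¹ = -v`.
  refine ⟨fun w => (w.2, -w.1), fun u w => ?_⟩
  obtain ⟨a, b⟩ := u
  obtain ⟨c, d⟩ := w
  simp [inner₂, inner_neg_left, inner_neg_right, add_comm]

variable {D : Ck S k x →ₗ.[ℂ] Ck S k x}

lemma inner₂_graph_map_vMap_eq_zero
    (hD : ∀ e f : D.domain, inner (D e) (f : Ck S k x) = inner (e : Ck S k x) (D f))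
    {u w : Ck S k x × Ck S k x} (hu : u ∈ D.graph) (hw : w ∈ D.graph.map (vMap (Ck S k x))) :
    inner₂ u w = 0 := by
  obtain ⟨w, hw, rfl⟩ := hw
  obtain ⟨a, b⟩ := u
  obtain ⟨c, d⟩ := w
  obtain ⟨e, rfl, rfl⟩ := D.mem_graph_iff.1 hu
  obtain ⟨f, rfl, rfl⟩ := D.mem_graph_iff.1 hw
  simp [inner₂, inner_neg_right, hD]

/-- Symmetry makes the intersection trivial, and surjectivity of `D ± i` makes the sum everything.
The complement is exhibited explicitly, which avoids the problem that closed submodules of a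
C⋆-module need not be complemented. -/
lemma IsSelfAdjointRegular.isCompl (hD : IsSelfAdjointRegular D) :
    IsCompl D.graph (D.graph.map (vMap (Ck S k x))) := by
  refine ⟨Submodule.disjoint_def.2 fun u hu hw => eq_zero_of_inner₂_self
    (inner₂_graph_map_vMap_eq_zero hD.symmetric hu hw), codisjoint_iff.2 ?_⟩
  exact graph_sup_map_vMap_eq_top hD.range_add hD.range_sub

/-- A projection along an orthogonal decomposition is selfadjoint. -/
lemma isAdjoint₂_projection {p q : Submodule ℂ (Ck S k x × Ck S k x)} (h : IsCompl p q)
    (hpq : ∀ u ∈ p, ∀ w ∈ q, inner₂ u w = 0) :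
    IsAdjoint₂ (Submodule.projection p q h) (Submodule.projection p q h) := by
  have hqp : ∀ w ∈ q, ∀ u ∈ p, inner₂ w u = 0 := fun w hw u hu => by
    rw [← star_inner₂, hpq u hu w hw, star_zero]
  intro u w
  set P := Submodule.projection p q h
  have hP : ∀ u, P u ∈ p := Submodule.projection_apply_mem h
  have hP' : ∀ u, u - P u ∈ q := Submodule.sub_projection_mem h
  -- Both sides equal `⟨P u, P w⟩`, because the cross terms vanish.
  calc inner₂ (P u) w = inner₂ (P u) (P w + (w - P w)) := by rw [add_sub_cancel]
    _ = inner₂ (P u) (P w) := by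
      rw [inner₂_add_right, hpq _ (hP u) _ (hP' w), add_zero]
    _ = inner₂ (P u + (u - P u)) (P w) := by
      rw [inner₂_add_left, hqp _ (hP' u) _ (hP w), add_zero]
    _ = inner₂ u (P w) := by rw [add_sub_cancel]

end Ck

end NCG

/-! ### The Woronowicz projection of a selfadjoint regular operator -/

theorem mainTheorem6 {B H E : Type*}
    [NonUnitalCStarAlgebra B] [PartialOrder B] [StarOrderedRing B]
    [TopologicalSpace.SeparableSpace B]
    [NormedAddCommGroup H] [InnerProductSpace ℂ H] [CompleteSpace H]
    (S : NCG.SpectralData B H) (k : ℕ) (hS : S.IsCk k)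
    [NormedAddCommGroup E] [NormedSpace ℂ E] [CompleteSpace E]
    [SMul Bᵐᵒᵖ E] [CStarModule Bᵐᵒᵖ E]
    (x : ℤ → E) (hx : NCG.IsCkFrame S k x)
    (D : NCG.Ck S k x →ₗ.[ℂ] NCG.Ck S k x) (hD : NCG.Ck.IsSelfAdjointRegular D) :
    ∃ p : (NCG.Ck S k x × NCG.Ck S k x) →ₗ[ℂ] (NCG.Ck S k x × NCG.Ck S k x),
      NCG.IsWoronowiczMatrix D p ∧
      ((p : _ → _) ∈ NCG.Ck.EndStar₂ S k x ∧ (∀ u, p (p u) = p u) ∧ NCG.Ck.IsAdjoint₂ p p) ∧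
      LinearMap.range p = D.graph ∧
      ((NCG.vMap (NCG.Ck S k x) : _ → _) ∈ NCG.Ck.EndStar₂ S k x ∧
        Function.Bijective (NCG.vMap (NCG.Ck S k x)) ∧
        ∀ u w : NCG.Ck S k x × NCG.Ck S k x,
          NCG.Ck.inner₂ (NCG.vMap _ u) (NCG.vMap _ w) = NCG.Ck.inner₂ u w) ∧
      IsCompl D.graph (D.graph.map (NCG.vMap (NCG.Ck S k x))) ∧
      ∀ u ∈ D.graph, ∀ w ∈ D.graph.map (NCG.vMap (NCG.Ck S k x)), NCG.Ck.inner₂ u w = 0 := by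
  have horth := fun u hu w hw =>
    NCG.Ck.inner₂_graph_map_vMap_eq_zero hD.symmetric (u := u) (w := w) hu hw
  have hadj := NCG.Ck.isAdjoint₂_projection hD.isCompl horth
  -- The projection is its own adjoint, which also witnesses its membership in `EndStar₂`. Only
  -- idempotence is left.
  refine ⟨Submodule.projection _ _ hD.isCompl, NCG.isWoronowiczMatrix_projection hD.isCompl,
    ⟨⟨_, hadj⟩, fun u => ?_, hadj⟩, Submodule.range_projection hD.isCompl,
    ⟨NCG.Ck.vMap_mem_endStar₂, NCG.vMap_bijective, NCG.Ck.inner₂_vMap_vMap⟩, hD.isCompl, horth⟩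
  exact Submodule.projection_apply_left hD.isCompl
    ⟨_, Submodule.projection_apply_mem hD.isCompl u⟩
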